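/- Let $n\ge 1$ and let $\mathfrak S_n$ be the symmetric group, its elements written as words $\sigma=x_1x_2\cdots x_n$ with $x_i=\sigma(i)$. For a word $w=y_1\cdots y_m$ of integers let $\operatorname{maj} w$ be the sum of its descent places, i.e. of all $i$ with $1\le i\le m-1$ and $y_i>y_{i+1}$. Put $\operatorname{Ligne}\sigma=\{i : 1\le i\le n-1,\ x_i>x_{i+1}\}$ and $\operatorname{Iligne}\sigma=\operatorname{Ligne}\sigma^{-1}$. A word $d_1\cdots d_n$ of integers is subdiagonal if $0\le d_i\le n-i$ for all $i$. Let $\operatorname{Mc}\sigma=d_1\cdots d_n$ with $d_i=\operatorname{maj}(\sigma^{(i)})-\operatorname{maj}(\sigma^{(i+1)})$, where $\sigma^{(i)}$ is the subword of $\sigma$ obtained by erasing the letters smaller than $i$. Let $\operatorname{Lc}\sigma=d_1\cdots d_n$ with $d_i=\#\{j : i+1\le j\le n,\ x_i>x_j\}$, and $\operatorname{Ic}\sigma=\operatorname{Lc}(\sigma^{-1})$. For a word $w$ let $\operatorname{sort} w$ be its nondecreasing rearrangement. Theorem 1. The maps $\operatorname{Mc}$ and $\operatorname{Ic}$ are bijections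 of $\mathfrak S_n$ onto the set of subdiagonal words of length $n$; hence there is a unique set-valued map $\operatorname{El}$ on the subdiagonal words of length $n$ such that $\operatorname{Ligne}\sigma=\operatorname{El}(\operatorname{Mc}\sigma)$ for all $\sigma\in\mathfrak S_n$. The triples $$(\operatorname{Iligne},\ \operatorname{sort}\circ\operatorname{Mc},\ \operatorname{El}\circ\operatorname{Mc})\quad\text{and}\quad(\operatorname{Iligne},\ \operatorname{sort}\circ\operatorname{Ic},\ \operatorname{El}\circ\operatorname{Ic})$$ are equidistributed on $\mathfrak S_n$: every value is taken by the same number of permutations $\sigma\in\mathfrak S_n$ under both triples. -/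

import Mathlib

namespace EulerMahonian

/-- The descent places `{i ∣ 1 ≤ i ≤ n - 1, y_i > y_{i+1}}` of a word `w = y_1 y_2 ⋯ y_n`
(positions are counted from `1`; the list entry of index `i` is the letter `y_{i+1}`). -/
def descentPlaces (w : List ℕ) : Finset ℕ :=
  (Finset.Ico 1 w.length).filter fun i => w.getD i 0 < w.getD (i - 1) 0

/-- The major index of a word: the sum of its descent places. -/
def maj (w : List ℕ) : ℕ := ∑ i ∈ descentPlaces w, i

/-- The permutation `σ` as the word `x_1 x_2 ⋯ x_n`, with letters in `{1, …, n}`. -/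
def word {n : ℕ} (σ : Equiv.Perm (Fin n)) : List ℕ := List.ofFn fun i => (σ i : ℕ) + 1

/-- The ligne of route: the set of all descent places of `σ`. -/
def Ligne {n : ℕ} (σ : Equiv.Perm (Fin n)) : Finset ℕ := descentPlaces (word σ)

/-- The inverse ligne of route. -/
def Iligne {n : ℕ} (σ : Equiv.Perm (Fin n)) : Finset ℕ := Ligne σ⁻¹

/-- The subword of `σ` obtained by erasing the letters smaller than `k`. -/
def eraseBelow {n : ℕ} (σ : Equiv.Perm (Fin n)) (k : ℕ) : List ℕ :=
  (word σ).filter fun x => k ≤ x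

/-- A word `d_1 d_2 ⋯ d_n` of integers is subdiagonal if `0 ≤ d_i ≤ n - i` for all `i`
(`d i` is the letter `d_{i+1}`). -/
def IsSubdiagonal {n : ℕ} (d : Fin n → ℤ) : Prop :=
  ∀ i : Fin n, 0 ≤ d i ∧ d i ≤ (n : ℤ) - ((i : ℕ) + 1)

/-- The Mc-code: `d_i` is the major index of `σ` without the letters smaller than `i`, minus
the major index of `σ` without the letters smaller than `i + 1`. -/
def Mc {n : ℕ} (σ : Equiv.Perm (Fin n)) : Fin n → ℤ := fun i =>
  (maj (eraseBelow σ (i + 1)) : ℤ) - (maj (eraseBelow σ (i + 2)) : ℤ)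

/-- The Lc-code: `d_i` is the number of `j` with `i < j ≤ n` and `x_i > x_j`. -/
def Lc {n : ℕ} (σ : Equiv.Perm (Fin n)) : Fin n → ℤ := fun i =>
  ((Finset.univ.filter fun j : Fin n => i < j ∧ σ j < σ i).card : ℤ)

/-- The Ic-code: the Lc-code of the inverse permutation. -/
def Ic {n : ℕ} (σ : Equiv.Perm (Fin n)) : Fin n → ℤ := Lc σ⁻¹

/-- The nondecreasing rearrangement of a word. -/
def sortWord {n : ℕ} (d : Fin n → ℤ) : List ℤ := (List.ofFn d).insertionSort (· ≤ ·)

/-- The statistic `El` on words of length `n`: the ligne of route of the permutation whose Mc-code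
is the given word (there is exactly one if the word is subdiagonal). -/
def El {n : ℕ} (d : Fin n → ℤ) : Finset ℕ :=
  (Finset.univ.filter fun σ : Equiv.Perm (Fin n) => Mc σ = d).biUnion Ligne

/-- Two statistics on `S_n` are equidistributed if each value is taken the same number of times. -/
def Equidistributed {n : ℕ} {α : Type*} [DecidableEq α] (f g : Equiv.Perm (Fin n) → α) : Prop :=
  ∀ a : α, (Finset.univ.filter fun σ => f σ = a).card = (Finset.univ.filter fun σ => g σ = a).card

end EulerMahonian

open EulerMahonian

namespace EulerMahonian

/-! Build a permutation by inserting the letters `n, n - 1, …, 1`, each smaller than all letters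
already present. The growth of `maj` at an insertion is the label of the chosen slot. It depends
only on the current descent set, and the labels of a word of length `m` are exactly `0, …, m`. The
labels, recorded from the last insertion to the first, form `Mc σ`, while the slot positions form
`Ic σ`. So `Ic` is obtained from `Mc` by `positions`, `El` reads the final descent set off `state`,
and `Iligne σ` is the descent set of the word `Ic σ`. It remains to compare, over subdiagonal words
`c`, the descents of `positions c` with those of `c`, jointly with `sort c` and `state c`.

By inclusion–exclusion it suffices to require these descents to lie in a set `T`. Then `T` cuts the
words into blocks, on which `positions c`, respectively `c`, must be nondecreasing. Sorting each
block of `c` is the bijection (`exists_bijOn`). It works for two reasons. A multiset of labels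
available before a block has exactly one order whose successive positions weakly decrease
(`exists_perm_pairwise_posList`, `eq_of_perm_of_pairwise_posList`). Inserting in that order yields
the same descent set as inserting in weakly decreasing order of labels (`run_eq_run_of_pairwise`).
-/

/-! ### Slots, labels and positions on bit words. -/

/-- Insertion of a new least letter, encoded on bit words. A word of length `m` is represented by
the bits `b_m, …, b_1, b_0`, where `b_0` is `true` and `b_p` tells whether `p` is a descent place.
The label `x` singles out one of these bits, which is replaced by `false, true`. -/
def ins : List Bool → ℕ → List Bool
  | [], _ => []
  | true :: u, 0 => false :: true :: u
  | true :: u, x + 1 => true :: ins u x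
  | false :: u, x => if x = u.length then false :: true :: u else false :: ins u x

/-- The position of the bit with label `x`. -/
def pos : List Bool → ℕ → ℕ
  | [], _ => 0
  | true :: u, 0 => u.length
  | true :: u, x + 1 => pos u x
  | false :: u, x => if x = u.length then u.length else pos u x

/-- Explicit form of the labelling, from which the later lemmas are read off: a bit `true` is
labelled by the number of `true` bits of greater position, a bit `false` by that number plus its own
position. -/
theorem exists_split {u : List Bool} {x : ℕ} (hx : x < u.length) :
    ∃ β b α, u = β ++ b :: α ∧ pos u x = α.length ∧ ins u x = β ++ false :: true :: α ∧
      x = if b then β.count true else β.count true + α.length := by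
  induction u generalizing x with
  | nil => simp at hx
  | cons c u ih =>
    cases c with
    | true =>
      cases x with
      | zero => exact ⟨[], true, u, by simp [pos, ins]⟩
      | succ x =>
        obtain ⟨β, b, α, h1, h2, h3, h4⟩ := ih (x := x) (by simpa using hx)
        refine ⟨true :: β, b, α, by simp [h1], by simp [pos, h2], by simp [ins, h3], ?_⟩
        split_ifs at h4 ⊢ <;> simp <;> omega
    | false =>
      by_cases hxu : x = u.length
      · exact ⟨[], false, u, by simp [pos, ins, hxu]⟩
      · obtain ⟨β, b, α, h1, h2, h3, h4⟩ := ih (x := x) (by simp at hx; omega)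
        refine ⟨false :: β, b, α, by simp [h1], by simp [pos, h2, hxu], by simp [ins, h3, hxu], ?_⟩
        simpa using h4

theorem length_ins {u : List Bool} {x : ℕ} (hx : x < u.length) :
    (ins u x).length = u.length + 1 := by
  obtain ⟨β, b, α, h1, -, h3, -⟩ := exists_split hx
  rw [h3, h1]; simp; omega

theorem pos_lt {u : List Bool} {x : ℕ} (hx : x < u.length) : pos u x < u.length := by
  obtain ⟨β, b, α, h1, h2, -, -⟩ := exists_split hx
  rw [h2, h1]; simp; omega

theorem pos_inj {u : List Bool} {x y : ℕ} (hx : x < u.length) (hy : y < u.length)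
    (h : pos u x = pos u y) : x = y := by
  obtain ⟨β, b, α, h1, h2, -, h4⟩ := exists_split hx
  obtain ⟨β', b', α', h1', h2', -, h4'⟩ := exists_split hy
  have hl : (b :: α).length = (b' :: α').length := by simp; omega
  obtain ⟨h5, h6⟩ := List.append_inj' (h1.symm.trans h1') hl
  simp only [List.cons.injEq] at h6
  rw [h4, h4', h5, h6.1, h6.2]

theorem pos_surj {u : List Bool} {p : ℕ} (hp : p < u.length) :
    ∃ x < u.length, pos u x = p := by
  have := Finset.surjOn_of_injOn_of_card_le (s := Finset.range u.length)
    (t := Finset.range u.length) (pos u) (fun x hx => by simpa using pos_lt (by simpa using hx))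
    (fun x hx y hy h => pos_inj (by simpa using hx) (by simpa using hy) h) le_rfl
  obtain ⟨x, hx, h⟩ := this (by simpa using hp)
  exact ⟨x, by simpa using hx, h⟩

/-- The labels of the bits of a suffix form an interval. -/
theorem pos_append_lt_iff (β α : List Bool) {y : ℕ} (hy : y < (β ++ α).length) :
    pos (β ++ α) y < α.length ↔ β.count true ≤ y ∧ y < β.count true + α.length := by
  induction β generalizing y with
  | nil => simpa [pos_lt] using ⟨fun h => hy, fun h => pos_lt hy⟩
  | cons c β ih =>
    cases c with
    | true =>
      cases y with
      | zero => simp [pos]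
      | succ y =>
        have := ih (y := y) (by simpa using hy)
        simp only [List.cons_append, pos, this, List.count_cons_self]
        omega
    | false =>
      have hc := List.count_le_length (a := true) (l := β)
      by_cases h : y = (β ++ α).length
      · simp [pos, h]; omega
      · have := ih (y := y) (by simp at hy h ⊢; omega)
        simp only [List.cons_append, pos, this, h, if_false]
        simp

theorem ins_append (β α : List Bool) {y : ℕ} (h1 : β.count true ≤ y)
    (h2 : y < β.count true + α.length) : ins (β ++ α) y = β ++ ins α (y - β.count true) := by
  induction β generalizing y with
  | nil => simp
  | cons c β ih =>
    cases c with
    | true =>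
      cases y with
      | zero => simp at h1
      | succ y =>
        simp only [List.count_cons_self] at h1 h2 ⊢
        simp only [List.cons_append, ins, ih (y := y) (by omega) (by omega)]
        simp
    | false =>
      have hc := List.count_le_length (a := true) (l := β)
      simp at h1 h2
      have h : y ≠ β.length + α.length := by omega
      simp [ins, h, ih h1 h2]

/-- The slots up to that of `x` carry an interval of labels. The insertion adds a `false` to the
prefix and leaves a suffix of the same length, so this interval does not change. -/
theorem pos_ins_le_iff {u : List Bool} {x y : ℕ} (hx : x < u.length) (hy : y < u.length) :
    pos (ins u x) y ≤ pos u x ↔ pos u y ≤ pos u x := by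
  obtain ⟨β, b, α, h1, h2, h3, -⟩ := exists_split hx
  have e1 := pos_append_lt_iff β (b :: α) (y := y) (by rw [← h1]; exact hy)
  have e2 := pos_append_lt_iff (β ++ [false]) (true :: α) (y := y)
    (by rw [h1] at hy; simp at hy ⊢; omega)
  rw [← h1] at e1
  simp only [List.append_assoc, List.singleton_append, ← h3] at e2
  simp [← h2] at e1 e2
  rw [e1, e2]

theorem lt_of_pos_ins_le {u : List Bool} {x y : ℕ} (hx : x < u.length) (hy : y < u.length + 1)
    (h : pos (ins u x) y ≤ pos u x) : y < u.length := by
  obtain ⟨β, b, α, h1, h2, h3, -⟩ := exists_split hx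
  have e2 := pos_append_lt_iff (β ++ [false]) (true :: α) (y := y)
    (by rw [h1] at hy; simp at hy ⊢; omega)
  simp only [List.append_assoc, List.singleton_append, ← h3] at e2
  have hc := List.count_le_length (a := true) (l := β)
  simp [← h2] at e2
  have := (e2.1 h).2
  rw [h1]; simp; omega

/-! ### Successive insertions with weakly decreasing positions. -/

/-- The result of the successive insertions with the labels in a list. -/
def run (u : List Bool) (xs : List ℕ) : List Bool := xs.foldl ins u

/-- The positions of the successive insertions with the labels in a list. -/
def posList : List Bool → List ℕ → List ℕ
  | _, [] => []
  | u, x :: xs => pos u x :: posList (ins u x) xs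

/-- Each label exists at the moment of its insertion. -/
def Fits : List Bool → List ℕ → Prop
  | _, [] => True
  | u, x :: xs => x < u.length ∧ Fits (ins u x) xs

theorem fits_of_forall_lt {u : List Bool} {xs : List ℕ} (h : ∀ x ∈ xs, x < u.length) :
    Fits u xs := by
  induction xs generalizing u with
  | nil => trivial
  | cons x xs ih =>
    have hx := h x (by simp)
    refine ⟨hx, ih fun y hy => ?_⟩
    rw [length_ins hx]
    exact Nat.lt_succ_of_lt (h y (by simp [hy]))

/-- Turns a condition on positions at the moments of insertion into one on the initial bit word,
which no longer depends on the order of the labels. -/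
theorem forall_posList_le_iff {u : List Bool} {xs : List ℕ} (h : ∀ x ∈ xs, x < u.length)
    (hp : (posList u xs).Pairwise (· ≥ ·)) (N : ℕ) :
    (∀ q ∈ posList u xs, q ≤ N) ↔ ∀ y ∈ xs, pos u y ≤ N := by
  induction xs generalizing u N with
  | nil => simp [posList]
  | cons y ys ih =>
    have hy := h y (by simp)
    simp only [posList, List.pairwise_cons] at hp
    have key := (ih (u := ins u y) (fun z hz => by
      rw [length_ins hy]; exact Nat.lt_succ_of_lt (h z (by simp [hz]))) hp.2 (pos u y)).1 hp.1
    simp only [posList, List.mem_cons, forall_eq_or_imp]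
    constructor
    · rintro ⟨h1, -⟩
      exact ⟨h1, fun z hz => ((pos_ins_le_iff hy (h z (by simp [hz]))).1 (key z hz)).trans h1⟩
    · rintro ⟨h1, -⟩
      exact ⟨h1, fun q hq => (hp.1 q hq).trans h1⟩

/-- The one label created by an insertion sits above the slot just used, so weakly decreasing
positions never reach it. -/
theorem forall_lt_of_fits {u : List Bool} {xs : List ℕ} (h : Fits u xs)
    (hp : (posList u xs).Pairwise (· ≥ ·)) : ∀ x ∈ xs, x < u.length := by
  induction xs generalizing u with
  | nil => simp
  | cons x xs ih =>
    have hp' := hp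
    simp only [posList, List.pairwise_cons] at hp'
    have h1 := ih h.2 hp'.2
    have h2 := (forall_posList_le_iff h1 hp'.2 _).1 hp'.1
    simp only [List.mem_cons, forall_eq_or_imp]
    refine ⟨h.1, fun y hy => lt_of_pos_ins_le h.1 ?_ (h2 y hy)⟩
    rw [← length_ins h.1]; exact h1 y hy

theorem pairwise_posList_cons_iff {u : List Bool} {x : ℕ} {xs : List ℕ} (hx : x < u.length)
    (h : ∀ x ∈ xs, x < u.length) :
    (posList u (x :: xs)).Pairwise (· ≥ ·) ↔
      (∀ y ∈ xs, pos u y ≤ pos u x) ∧ (posList (ins u x) xs).Pairwise (· ≥ ·) := by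
  simp only [posList, List.pairwise_cons]
  refine and_congr_left fun hp => ?_
  refine (forall_posList_le_iff (fun z hz => ?_) hp _).trans
    (forall₂_congr fun y hy => pos_ins_le_iff hx (h y hy))
  rw [length_ins hx]; exact Nat.lt_succ_of_lt (h z hz)

theorem exists_perm_pairwise_posList (u : List Bool) (l : List ℕ) (h : ∀ x ∈ l, x < u.length) :
    ∃ xs : List ℕ, xs.Perm l ∧ (posList u xs).Pairwise (· ≥ ·) := by
  induction hn : l.length generalizing u l with
  | zero => exact ⟨[], by simp_all [posList]⟩
  | succ n ih =>
    have hne : l.toFinset.Nonempty := by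
      rw [List.toFinset_nonempty_iff]; rintro rfl; simp at hn
    -- Greedy choice: the label of greatest current position has to come first.
    obtain ⟨x, hx, hmax⟩ := l.toFinset.exists_max_image (pos u) hne
    simp only [List.mem_toFinset] at hx hmax
    have hlt := h x hx
    obtain ⟨xs, hxs, hp⟩ := ih (ins u x) (l.erase x) (fun y hy => by
      rw [length_ins hlt]; exact Nat.lt_succ_of_lt (h y (List.mem_of_mem_erase hy)))
      (by rw [List.length_erase_of_mem hx, hn]; rfl)
    refine ⟨x :: xs, (hxs.cons x).trans (List.perm_cons_erase hx).symm, ?_⟩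
    have hmem : ∀ y ∈ xs, y ∈ l := fun y hy => List.mem_of_mem_erase (hxs.subset hy)
    rw [pairwise_posList_cons_iff hlt fun y hy => h y (hmem y hy)]
    exact ⟨fun y hy => hmax y (hmem y hy), hp⟩

theorem eq_of_perm_of_pairwise_posList {u : List Bool} {xs ys : List ℕ}
    (h : ∀ x ∈ xs, x < u.length) (hperm : xs.Perm ys)
    (hx : (posList u xs).Pairwise (· ≥ ·)) (hy : (posList u ys).Pairwise (· ≥ ·)) : xs = ys := by
  induction xs generalizing u ys with
  | nil => simpa using hperm.symm
  | cons x xs ih =>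
    cases ys with
    | nil => simp at hperm
    | cons y ys =>
      have h' : ∀ z ∈ y :: ys, z < u.length := fun z hz => h z (hperm.symm.subset hz)
      have hlt := h x (by simp)
      have hlt' := h' y (by simp)
      rw [pairwise_posList_cons_iff hlt fun z hz => h z (by simp [hz])] at hx
      rw [pairwise_posList_cons_iff hlt' fun z hz => h' z (by simp [hz])] at hy
      have hxy : x = y := by
        refine pos_inj hlt hlt' (le_antisymm ?_ ?_)
        · rcases List.mem_cons.1 (hperm.subset (List.mem_cons_self (a := x))) with e | e
          · rw [e]
          · exact hy.1 x e
        · rcases List.mem_cons.1 (hperm.symm.subset (List.mem_cons_self (a := y))) with e | e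
          · rw [e]
          · exact hx.1 y e
      subst hxy
      rw [ih (u := ins u x) (fun z hz => by
        rw [length_ins hlt]; exact Nat.lt_succ_of_lt (h z (by simp [hz]))) hperm.cons_inv hx.2 hy.2]

/-- The label of a bit `true` commutes with the labels of the bits of smaller position. -/
theorem ins_comm (β α : List Bool) {y : ℕ} (h1 : β.count true ≤ y)
    (h2 : y ≤ β.count true + α.length) :
    ins (ins (β ++ true :: α) (β.count true)) y = ins (ins (β ++ true :: α) y) (β.count true) := by
  rcases h1.eq_or_lt with rfl | h1
  · rfl
  have e0 : ∀ α', ins (β ++ true :: α') (β.count true) = β ++ false :: true :: α' := fun α' => by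
    rw [ins_append _ _ le_rfl (by simp)]; simp [ins]
  have e1 : ins (β ++ true :: α) y = β ++ true :: ins α (y - β.count true - 1) := by
    -- Since `y` exceeds the label of the `true` bit, its slot lies in `α`, and that bit can be
    -- absorbed into the prefix.
    have := ins_append (β ++ [true]) α (y := y) (by simp; omega) (by simp; omega)
    simpa [Nat.sub_sub] using this
  have e2 : ins (β ++ false :: true :: α) y =
      β ++ false :: true :: ins α (y - β.count true - 1) := by
    have := ins_append (β ++ [false, true]) α (y := y) (by simp; omega) (by simp; omega)
    simpa [Nat.sub_sub] using this
  rw [e0, e1, e0, e2]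

theorem run_cons_comm (β α : List Bool) (ys : List ℕ)
    (h : ∀ y ∈ ys, β.count true ≤ y ∧ y ≤ β.count true + α.length) :
    run (β ++ true :: α) (β.count true :: ys) = run (β ++ true :: α) (ys ++ [β.count true]) := by
  induction ys generalizing β α with
  | nil => rfl
  | cons y ys ih =>
    have hy := h y (by simp)
    have hys := fun z hz => h z (List.mem_cons_of_mem y hz)
    have e : run (β ++ true :: α) (β.count true :: y :: ys) =
        run (ins (β ++ true :: α) y) (β.count true :: ys) := by
      simp only [run, List.foldl_cons, ins_comm β α hy.1 hy.2]
    rw [e, List.cons_append]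
    change _ = run (ins (β ++ true :: α) y) (ys ++ [β.count true])
    rcases hy.1.eq_or_lt with rfl | hlt
    · have e0 : ins (β ++ true :: α) (β.count true) = (β ++ [false]) ++ true :: α := by
        rw [ins_append _ _ le_rfl (by simp)]; simp [ins]
      have ec : (β ++ [false]).count true = β.count true := by simp
      rw [e0]
      have := ih (β ++ [false]) α (by rw [ec]; exact hys)
      rwa [ec] at this
    · have e1 : ins (β ++ true :: α) y = β ++ true :: ins α (y - β.count true - 1) := by
        have := ins_append (β ++ [true]) α (y := y) (by simp; omega) (by simp; omega)
        simpa [Nat.sub_sub] using this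
      rw [e1]
      refine ih _ _ fun z hz => ?_
      rw [length_ins (by omega)]
      have := hys z hz
      omega

/-- By induction the labels after the first may be sorted; what remains is to move the first one to
its place. -/
theorem run_eq_run_of_pairwise {u : List Bool} {xs ys : List ℕ} (h : ∀ x ∈ xs, x < u.length)
    (hx : (posList u xs).Pairwise (· ≥ ·)) (hperm : ys.Perm xs) (hy : ys.Pairwise (· ≥ ·)) :
    run u xs = run u ys := by
  induction xs generalizing u ys with
  | nil => rw [List.perm_nil.1 hperm]
  | cons x xs ih =>
    have hlt := h x (by simp)
    have hxs := fun z hz => h z (List.mem_cons_of_mem x hz)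
    rw [pairwise_posList_cons_iff hlt hxs] at hx
    have hs := List.perm_insertionSort (· ≥ ·) xs
    have hsort := List.pairwise_insertionSort (· ≥ ·) xs
    have key : run u (x :: xs) = run u (x :: xs.insertionSort (· ≥ ·)) :=
      ih (u := ins u x) (fun z hz => by
        rw [length_ins hlt]; exact Nat.lt_succ_of_lt (hxs z hz)) hx.2 hs hsort
    obtain ⟨β, b, α, h1, h2, h3, h4⟩ := exists_split hlt
    have hint : ∀ y ∈ xs, β.count true ≤ y ∧ y ≤ β.count true + α.length := fun y hy => by
      have e1 := pos_append_lt_iff β (b :: α) (y := y) (by rw [← h1]; exact hxs y hy)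
      rw [← h1, List.length_cons] at e1
      have := e1.1 (by rw [← h2]; exact Nat.lt_succ_of_le (hx.1 y hy))
      omega
    rw [key]
    -- The later labels lie in the label interval of `b :: α`. If `b` is `false`, then `x` is its
    -- greatest element and already stands in the right place; if `b` is `true`, then `x` is its
    -- least element and commutes to the end.
    cases b with
    | false =>
      congr 1
      refine List.Perm.eq_of_pairwise' (r := (· ≥ ·)) ?_ hy ((hs.cons x).trans hperm.symm)
      refine List.pairwise_cons.2 ⟨fun y hy => ?_, hsort⟩
      have := hint y (hs.subset hy)
      simp at h4; omega
    | true =>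
      simp only [if_true] at h4
      rw [h1, h4, run_cons_comm β α _ fun y hy => hint y (hs.subset hy)]
      congr 1
      refine List.Perm.eq_of_pairwise' (r := (· ≥ ·)) ?_ hy
        (((List.perm_append_singleton _ _).trans (hs.cons _)).trans (by rw [← h4]; exact hperm.symm))
      refine List.pairwise_append.2 ⟨hsort, by simp, fun y hy z hz => ?_⟩
      rw [List.mem_singleton.1 hz]
      exact (hint y (hs.subset hy)).1


/-! ### Codes, their positions, and blocks of codes. -/

/-- The bit word of the permutation with a given code; the letters of the code are inserted from
right to left. -/
def state : List ℕ → List Bool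
  | [] => [true]
  | d :: ds => ins (state ds) d

/-- The positions of insertion that belong to a code. -/
def positions : List ℕ → List ℕ
  | [] => []
  | d :: ds => pos (state ds) d :: positions ds

/-- Subdiagonal words as lists of natural numbers. -/
def Subdiag : List ℕ → Prop
  | [] => True
  | d :: ds => d ≤ ds.length ∧ Subdiag ds

theorem length_state {c : List ℕ} (h : Subdiag c) : (state c).length = c.length + 1 := by
  induction c with
  | nil => rfl
  | cons d ds ih =>
    rw [state, length_ins (by rw [ih h.2]; exact Nat.lt_succ_of_le h.1), ih h.2]; rfl

theorem length_positions (c : List ℕ) : (positions c).length = c.length := by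
  induction c with
  | nil => rfl
  | cons d ds ih => simp [positions, ih]

theorem run_append (u : List Bool) (xs ys : List ℕ) : run u (xs ++ ys) = run (run u xs) ys :=
  List.foldl_append

theorem posList_append (u : List Bool) (xs ys : List ℕ) :
    posList u (xs ++ ys) = posList u xs ++ posList (run u xs) ys := by
  induction xs generalizing u with
  | nil => rfl
  | cons x xs ih => simp only [List.cons_append, posList, ih]; rfl

theorem fits_append (u : List Bool) (xs ys : List ℕ) :
    Fits u (xs ++ ys) ↔ Fits u xs ∧ Fits (run u xs) ys := by
  induction xs generalizing u with
  | nil => simp [Fits, run]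
  | cons x xs ih => simp only [List.cons_append, Fits, ih, and_assoc]; rfl

theorem state_append (b r : List ℕ) : state (b ++ r) = run (state r) b.reverse := by
  induction b with
  | nil => rfl
  | cons d b ih => rw [List.cons_append, state, ih, List.reverse_cons, run_append]; rfl

theorem positions_append (b r : List ℕ) :
    positions (b ++ r) = (posList (state r) b.reverse).reverse ++ positions r := by
  induction b with
  | nil => rfl
  | cons d b ih =>
    rw [List.cons_append, positions, ih, List.reverse_cons, posList_append, state_append]
    simp [posList]

theorem subdiag_append (b r : List ℕ) :
    Subdiag (b ++ r) ↔ Fits (state r) b.reverse ∧ Subdiag r := by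
  induction b with
  | nil => simp [Fits]
  | cons d b ih =>
    rw [List.cons_append, Subdiag, ih, List.reverse_cons, fits_append, ← state_append]
    constructor
    · rintro ⟨h1, h2, h3⟩
      refine ⟨⟨h2, ?_, trivial⟩, h3⟩
      rw [length_state (ih.2 ⟨h2, h3⟩)]; omega
    · rintro ⟨⟨h2, h1, -⟩, h3⟩
      rw [length_state (ih.2 ⟨h2, h3⟩)] at h1
      exact ⟨by omega, h2, h3⟩

theorem subdiag_of_forall_le {b r : List ℕ} (hr : Subdiag r) (h : ∀ x ∈ b, x ≤ r.length) :
    Subdiag (b ++ r) :=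
  (subdiag_append b r).2 ⟨fits_of_forall_lt fun x hx => by
    rw [length_state hr]; exact Nat.lt_succ_of_le (h x (List.mem_reverse.1 hx)), hr⟩

/-- The last letter of the block is the greatest and is bounded by `r.length`. This is the
counterpart of `forall_lt_of_fits` for sorted blocks. -/
theorem forall_le_of_subdiag {b r : List ℕ} (h : Subdiag (b ++ r)) (hb : b.Pairwise (· ≤ ·)) :
    ∀ x ∈ b, x ≤ r.length := by
  induction b with
  | nil => simp
  | cons d b ih =>
    rw [List.pairwise_cons] at hb
    have := ih h.2 hb.2
    rw [List.forall_mem_cons]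
    refine ⟨?_, this⟩
    cases b with
    | nil => exact h.1
    | cons e b => exact (hb.1 e (by simp)).trans (this e (by simp))

theorem mem_descentPlaces {w : List ℕ} {i : ℕ} :
    i ∈ descentPlaces w ↔ (1 ≤ i ∧ i < w.length) ∧ w.getD i 0 < w.getD (i - 1) 0 := by
  simp [descentPlaces]

/-- The descents of `p ++ q` lie in `T`, where no element of `T` is a place inside `p`. -/
theorem descentPlaces_append_subset_iff {p q : List ℕ} {T : Set ℕ}
    (h1 : ∀ i, 1 ≤ i → i < p.length → i ∉ T) (h2 : q ≠ [] → p.length ∈ T) (hp : p ≠ []) :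
    (∀ i ∈ descentPlaces (p ++ q), i ∈ T) ↔
      p.Pairwise (· ≤ ·) ∧ ∀ i ∈ descentPlaces q, i + p.length ∈ T := by
  have hpl : 0 < p.length := List.length_pos_iff.2 hp
  simp only [mem_descentPlaces]
  constructor
  · intro h
    constructor
    · rw [← List.isChain_iff_pairwise, List.isChain_iff_getElem]
      intro i hi
      by_contra! hlt
      refine h1 (i + 1) (by omega) hi (h (i + 1) ⟨by simp; omega, ?_⟩)
      have a1 : i < p.length := by omega
      rw [Nat.add_sub_cancel, List.getD_append _ _ _ _ hi, List.getD_append _ _ _ _ a1,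
        List.getD_eq_getElem _ _ hi, List.getD_eq_getElem _ _ a1]
      exact hlt
    · rintro i ⟨⟨hi1, hi2⟩, hi⟩
      refine h _ ⟨by simp; omega, ?_⟩
      rw [List.getD_append_right _ _ _ _ (by omega), List.getD_append_right _ _ _ _ (by omega)]
      rwa [Nat.add_sub_cancel, show i + p.length - 1 - p.length = i - 1 by omega]
  · rintro ⟨hs, hq⟩ i ⟨⟨hi1, hi2⟩, hi⟩
    rcases lt_trichotomy i p.length with hlt | rfl | hlt
    · exfalso
      have a1 : i - 1 < p.length := by omega
      rw [List.getD_append _ _ _ _ hlt, List.getD_append _ _ _ _ a1,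
        List.getD_eq_getElem _ _ hlt, List.getD_eq_getElem _ _ a1] at hi
      exact absurd (List.pairwise_iff_getElem.1 hs (i - 1) i a1 hlt (by omega)) (by omega)
    · exact h2 (by rintro rfl; simp at hi2)
    · have := hq (i - p.length) ⟨by simp at hi2; omega, by
        rw [List.getD_append_right _ _ _ _ (by omega),
          List.getD_append_right _ _ _ _ (by omega)] at hi
        rwa [show i - 1 - p.length = i - p.length - 1 by omega] at hi⟩
      rwa [Nat.sub_add_cancel hlt.le] at this

/-- The subdiagonal words for which the descents of `f c` lie in `T`. -/
def subdiagSet (f : List ℕ → List ℕ) (n : ℕ) (T : Set ℕ) : Set (List ℕ) :=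
  {c | c.length = n ∧ Subdiag c ∧ ∀ i ∈ descentPlaces (f c), i ∈ T}

/-- Together with `append_mem_subdiagSet_id`, this gives both sides the same range condition on the
first block; only the order condition differs. The block is reversed because its rightmost letter is
inserted first. -/
theorem append_mem_subdiagSet_positions {b r : List ℕ} {n : ℕ} {T : Set ℕ} (hb : b ≠ [])
    (h1 : ∀ i, 1 ≤ i → i < b.length → i ∉ T) (h2 : r ≠ [] → b.length ∈ T) :
    b ++ r ∈ subdiagSet positions (b.length + n) T ↔
      ((∀ x ∈ b, x < (state r).length) ∧ (posList (state r) b.reverse).Pairwise (· ≥ ·)) ∧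
      r ∈ subdiagSet positions n {i | i + b.length ∈ T} := by
  have hl : (posList (state r) b.reverse).reverse.length = b.length := by
    have := congrArg List.length (positions_append b r)
    simp only [length_positions, List.length_append] at this
    omega
  have hq : positions r ≠ [] → r ≠ [] := by rintro h rfl; exact h rfl
  simp only [subdiagSet, Set.mem_ofPred_eq, positions_append, subdiag_append, List.length_append,
    Nat.add_left_cancel_iff]
  rw [descentPlaces_append_subset_iff (by rwa [hl]) (fun h => by rw [hl]; exact h2 (hq h))
    (by rw [← List.length_pos_iff, hl]; exact List.length_pos_iff.2 hb), hl, List.pairwise_reverse]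
  constructor
  · rintro ⟨h3, ⟨h4, h5⟩, h6, h7⟩
    exact ⟨⟨fun x hx => forall_lt_of_fits h4 h6 x (List.mem_reverse.2 hx), h6⟩, h3, h5, h7⟩
  · rintro ⟨⟨h4, h6⟩, h3, h5, h7⟩
    exact ⟨h3, ⟨fits_of_forall_lt fun x hx => h4 x (List.mem_reverse.1 hx), h5⟩, h6, h7⟩

theorem append_mem_subdiagSet_id {b r : List ℕ} {n : ℕ} {T : Set ℕ} (hb : b ≠ [])
    (h1 : ∀ i, 1 ≤ i → i < b.length → i ∉ T) (h2 : r ≠ [] → b.length ∈ T) :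
    b ++ r ∈ subdiagSet id (b.length + n) T ↔
      ((∀ x ∈ b, x < (state r).length) ∧ b.Pairwise (· ≤ ·)) ∧
      r ∈ subdiagSet id n {i | i + b.length ∈ T} := by
  simp only [subdiagSet, Set.mem_ofPred_eq, List.length_append, Nat.add_left_cancel_iff, id]
  rw [descentPlaces_append_subset_iff h1 h2 hb]
  constructor
  · rintro ⟨h3, h4, h6, h7⟩
    have hr := ((subdiag_append b r).1 h4).2
    rw [length_state hr]
    exact ⟨⟨fun x hx => Nat.lt_succ_of_le (forall_le_of_subdiag h4 h6 x hx), h6⟩, h3, hr, h7⟩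
  · rintro ⟨⟨h4, h6⟩, h3, h5, h7⟩
    rw [length_state h5] at h4
    exact ⟨h3, subdiag_of_forall_le h5 fun x hx => Nat.le_of_lt_succ (h4 x hx), h6, h7⟩

/-- The length of the initial block cut off by `T`. -/
theorem exists_block (n : ℕ) (T : Set ℕ) :
    ∃ l m, l + m = n + 1 ∧ 0 < l ∧ (∀ i, 1 ≤ i → i < l → i ∉ T) ∧ (0 < m → l ∈ T) := by
  classical
  -- The value `n + 1` is the fallback when `T` has no element in `1, …, n`; the block is then the
  -- whole word.
  have hex : ∃ l, 0 < l ∧ (l ∈ T ∨ l = n + 1) := ⟨n + 1, by simp⟩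
  have hs := Nat.find_spec hex
  have hle : Nat.find hex ≤ n + 1 := Nat.find_min' hex ⟨by simp, Or.inr rfl⟩
  refine ⟨Nat.find hex, n + 1 - Nat.find hex, by omega, hs.1, fun i h1 h2 hT =>
    Nat.find_min hex h2 ⟨h1, Or.inl hT⟩, fun hm => hs.2.resolve_right (by omega)⟩

/-- Induction on the number of letters, peeling off the first block, which is inserted last. The
conditions on it involve the rest `r` only through `state r`, which the bijection on the rest
preserves. -/
theorem exists_bijOn (n : ℕ) (T : Set ℕ) : ∃ f : List ℕ → List ℕ,
    Set.BijOn f (subdiagSet positions n T) (subdiagSet id n T) ∧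
    ∀ c ∈ subdiagSet positions n T, (f c).Perm c ∧ state (f c) = state c := by
  induction n using Nat.strong_induction_on generalizing T with
  | _ n ih =>
  cases n with
  | zero =>
    have h0 : ∀ f : List ℕ → List ℕ, f [] = [] → subdiagSet f 0 T = {[]} := fun f hf => by
      ext c
      simp only [subdiagSet, List.length_eq_zero_iff, Set.mem_ofPred_eq, Set.mem_singleton_iff]
      refine ⟨fun h => h.1, ?_⟩
      rintro rfl
      exact ⟨rfl, trivial, by simp [hf, descentPlaces]⟩
    refine ⟨id, ?_, fun c _ => ⟨List.Perm.refl _, rfl⟩⟩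
    rw [h0 positions rfl, h0 id rfl]
    exact Set.bijOn_id _
  | succ n =>
    obtain ⟨l, m, hlm, hl, hT1, hT2⟩ := exists_block n T
    obtain ⟨f, ⟨hf1, hf2, hf3⟩, hf4⟩ := ih m (by omega) {i | i + l ∈ T}
    have hsplit : ∀ c : List ℕ, c.length = n + 1 →
        ∃ b r, c = b ++ r ∧ b.length = l ∧ r.length = m := fun c hc =>
      ⟨c.take l, c.drop l, (List.take_append_drop l c).symm, by simp; omega, by simp; omega⟩
    have hne : ∀ b : List ℕ, b.length = l → b ≠ [] := by rintro _ h rfl; simp at h; omega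
    have hTr : ∀ r : List ℕ, r.length = m → r ≠ [] → l ∈ T := fun r h1 h2 =>
      hT2 (h1 ▸ List.length_pos_iff.2 h2)
    have hP : ∀ b r : List ℕ, b.length = l → r.length = m →
        (b ++ r ∈ subdiagSet positions (n + 1) T ↔
          ((∀ x ∈ b, x < (state r).length) ∧ (posList (state r) b.reverse).Pairwise (· ≥ ·)) ∧
          r ∈ subdiagSet positions m {i | i + l ∈ T}) := by
      rintro b r rfl hr
      rw [← hlm]
      exact append_mem_subdiagSet_positions (hne b rfl) hT1 (hTr r hr)
    have hI : ∀ b r : List ℕ, b.length = l → r.length = m →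
        (b ++ r ∈ subdiagSet id (n + 1) T ↔
          ((∀ x ∈ b, x < (state r).length) ∧ b.Pairwise (· ≤ ·)) ∧
          r ∈ subdiagSet id m {i | i + l ∈ T}) := by
      rintro b r rfl hr
      rw [← hlm]
      exact append_mem_subdiagSet_id (hne b rfl) hT1 (hTr r hr)
    set g : List ℕ → List ℕ := fun c => (c.take l).insertionSort (· ≤ ·) ++ f (c.drop l) with hg
    have hgv : ∀ b r : List ℕ, b.length = l → g (b ++ r) = b.insertionSort (· ≤ ·) ++ f r := by
      rintro b r rfl
      simp [hg]
    have hperm : ∀ b : List ℕ, (b.insertionSort (· ≤ ·)).Perm b :=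
      fun b => List.perm_insertionSort _ b
    have hsort : ∀ b : List ℕ, (b.insertionSort (· ≤ ·)).Pairwise (· ≤ ·) :=
      fun b => List.pairwise_insertionSort _ b
    refine ⟨g, ⟨?_, ?_, ?_⟩, ?_⟩
    · intro c hc
      obtain ⟨b, r, rfl, hb, hr⟩ := hsplit c hc.1
      rw [hP b r hb hr] at hc
      rw [hgv b r hb, hI _ _ ((hperm b).length_eq.trans hb) (hf1 hc.2).1, (hf4 r hc.2).2]
      exact ⟨⟨fun x hx => hc.1.1 x ((hperm b).subset hx), hsort b⟩, hf1 hc.2⟩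
    · intro c hc c' hc' h
      obtain ⟨b, r, rfl, hb, hr⟩ := hsplit c hc.1
      obtain ⟨b', r', rfl, hb', hr'⟩ := hsplit c' hc'.1
      rw [hP b r hb hr] at hc
      rw [hP b' r' hb' hr'] at hc'
      rw [hgv b r hb, hgv b' r' hb'] at h
      obtain ⟨h1, h2⟩ := List.append_inj h
        (by rw [(hperm b).length_eq, (hperm b').length_eq, hb, hb'])
      have hrr : r = r' := hf2 hc.2 hc'.2 h2
      subst hrr
      have hbb : b.Perm b' := (hperm b).symm.trans (h1 ▸ hperm b')
      have := eq_of_perm_of_pairwise_posList (u := state r)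
        (fun x hx => hc.1.1 x (List.mem_reverse.1 hx))
        ((List.reverse_perm b).trans (hbb.trans (List.reverse_perm b').symm)) hc.1.2 hc'.1.2
      rw [List.reverse_injective this]
    · intro c hc
      obtain ⟨b, r, rfl, hb, hr⟩ := hsplit c hc.1
      rw [hI b r hb hr] at hc
      obtain ⟨r', hr', rfl⟩ := hf3 hc.2
      rw [(hf4 r' hr').2] at hc
      obtain ⟨xs, hxs, hp⟩ := exists_perm_pairwise_posList (state r') b hc.1.1
      have hxb : xs.reverse.Perm b := (List.reverse_perm xs).trans hxs
      have hxl := hxb.length_eq.trans hb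
      refine ⟨xs.reverse ++ r', ?_, ?_⟩
      · rw [hP _ _ hxl hr'.1, List.reverse_reverse]
        exact ⟨⟨fun x hx => hc.1.1 x (hxb.subset hx), hp⟩, hr'⟩
      · rw [hgv _ _ hxl]
        congr 1
        exact List.Perm.eq_of_pairwise' (hsort _) hc.1.2 ((hperm _).trans hxb)
    · intro c hc
      obtain ⟨b, r, rfl, hb, hr⟩ := hsplit c hc.1
      rw [hP b r hb hr] at hc
      rw [hgv b r hb]
      refine ⟨(hperm b).append (hf4 r hc.2).1, ?_⟩
      rw [state_append, state_append, (hf4 r hc.2).2]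
      refine (run_eq_run_of_pairwise (fun x hx => hc.1.1 x (List.mem_reverse.1 hx)) hc.1.2
        ((List.reverse_perm _).trans ((hperm b).trans (List.reverse_perm b).symm)) ?_).symm
      rw [List.pairwise_reverse]
      exact hsort b

/-! ### Inclusion–exclusion on descent sets. -/

/-- Two statistics with the same numbers of elements of value inside `T`, for each `T`, have the
same numbers of elements of value `T`. -/
theorem card_filter_eq_of_card_filter_subset {α : Type*} (s t : Finset α) (f g : α → Finset ℕ)
    (h : ∀ T, (s.filter fun a => f a ⊆ T).card = (t.filter fun a => g a ⊆ T).card)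
    (T : Finset ℕ) : (s.filter fun a => f a = T).card = (t.filter fun a => g a = T).card := by
  induction T using Finset.strongInduction with
  | H T ih =>
    have key : ∀ (s : Finset α) (f : α → Finset ℕ), (s.filter fun a => f a ⊆ T).card =
        (s.filter fun a => f a = T).card +
          ∑ S ∈ T.ssubsets, (s.filter fun a => f a = S).card := by
      intro s f
      rw [Finset.card_eq_sum_card_fiberwise (f := f) (t := T.powerset)
        (fun a ha => by simpa using (Finset.mem_filter.1 ha).2)]
      have hT : T.powerset = insert T T.ssubsets := by
        rw [Finset.ssubsets, Finset.insert_erase (Finset.mem_powerset_self T)]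
      rw [hT, Finset.sum_insert (by simp [Finset.ssubsets])]
      have hfib : ∀ S ⊆ T, ((s.filter fun a => f a ⊆ T).filter fun a => f a = S) =
          s.filter fun a => f a = S := fun S hS => by
        rw [Finset.filter_filter]
        exact Finset.filter_congr fun a _ => ⟨fun h => h.2, fun h => ⟨h ▸ hS, h⟩⟩
      rw [hfib T le_rfl]
      congr 1
      exact Finset.sum_congr rfl fun S hS => by rw [hfib S (Finset.mem_ssubsets.1 hS).1]
    have h1 := h T
    rw [key s f, key t g, Finset.sum_congr rfl fun S hS => ih S (Finset.mem_ssubsets.1 hS)] at h1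
    exact Nat.add_right_cancel h1


/-! ### Descent sets and major index through bit words. -/

/-- The bit word of a word of length `m` with descent set `D`. -/
def bits (D : Finset ℕ) : ℕ → List Bool
  | 0 => [true]
  | m + 1 => decide (m + 1 ∈ D) :: bits D m

theorem length_bits (D : Finset ℕ) (m : ℕ) : (bits D m).length = m + 1 := by
  induction m with
  | zero => rfl
  | succ m ih => simp [bits, ih]

theorem bits_congr {D D' : Finset ℕ} {m : ℕ} (h : ∀ i, 1 ≤ i → i ≤ m → (i ∈ D ↔ i ∈ D')) :
    bits D m = bits D' m := by
  induction m with
  | zero => rfl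
  | succ m ih =>
    simp only [bits, ih fun i h1 h2 => h i h1 (h2.trans (Nat.le_succ m)),
      h (m + 1) (by omega) le_rfl]

/-- The set of the positions other than `0` of the bits `true`. -/
def descentsOfBits : List Bool → Finset ℕ
  | [] => ∅
  | true :: u => if u = [] then ∅ else insert u.length (descentsOfBits u)
  | false :: u => descentsOfBits u

theorem descentsOfBits_bits {D : Finset ℕ} {m : ℕ} (h : D ⊆ Finset.Icc 1 m) :
    descentsOfBits (bits D m) = D := by
  have key : ∀ m, descentsOfBits (bits D m) = D.filter (· ≤ m) := by
    intro m
    have h1 : ∀ i ∈ D, 1 ≤ i := fun i hi => (Finset.mem_Icc.1 (h hi)).1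
    induction m with
    | zero =>
      symm
      simp only [bits, descentsOfBits, if_true, Finset.filter_eq_empty_iff]
      intro i hi
      have := h1 i hi
      omega
    | succ m ih =>
      have hne : bits D m ≠ [] := by
        rw [← List.length_pos_iff, length_bits]; omega
      by_cases hm : m + 1 ∈ D
      · simp only [bits, hm, decide_true, descentsOfBits, hne, if_false, ih, length_bits]
        ext i
        simp only [Finset.mem_insert, Finset.mem_filter]
        constructor
        · rintro (rfl | ⟨h2, h3⟩)
          · exact ⟨hm, le_rfl⟩
          · exact ⟨h2, by omega⟩
        · rintro ⟨h2, h3⟩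
          rcases h3.eq_or_lt with rfl | h3
          · exact Or.inl rfl
          · exact Or.inr ⟨h2, by omega⟩
      · simp only [bits, hm, decide_false, descentsOfBits, ih]
        refine Finset.filter_congr fun i hi => ⟨fun h3 => by omega, fun h3 => ?_⟩
        have : i ≠ m + 1 := by rintro rfl; exact hm hi
        omega
  rw [key, Finset.filter_true_of_mem fun i hi => (Finset.mem_Icc.1 (h hi)).2]

/-- The sum of the positions of the bits `true`. -/
def weight : List Bool → ℕ
  | [] => 0
  | true :: u => u.length + weight u
  | false :: u => weight u

/-- The reason for the labelling: the label is the increase of the major index. The bit of position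
`0`, always `true` in `bits`, contributes nothing. -/
theorem weight_ins {u : List Bool} {x : ℕ} (hx : x < u.length) :
    weight (ins u x) = weight u + x := by
  induction u generalizing x with
  | nil => simp at hx
  | cons c u ih =>
    cases c with
    | true =>
      cases x with
      | zero => rfl
      | succ x =>
        have hx' : x < u.length := by simpa using hx
        simp only [ins, weight, length_ins hx', ih hx']
        omega
    | false =>
      by_cases h : x = u.length
      · simp only [ins, h, if_true, weight]; omega
      · have hx' : x < u.length := by simp at hx; omega
        simp only [ins, h, if_false, weight, ih hx']

theorem weight_bits {D : Finset ℕ} {m : ℕ} (h : D ⊆ Finset.Icc 1 m) :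
    weight (bits D m) = ∑ i ∈ D, i := by
  have key : ∀ m, weight (bits D m) = ∑ i ∈ Finset.Icc 1 m, if i ∈ D then i else 0 := by
    intro m
    induction m with
    | zero => rfl
    | succ m ih =>
      rw [Finset.sum_Icc_succ_top (by omega), ← ih]
      by_cases hm : m + 1 ∈ D
      · simp [bits, hm, weight, length_bits]; omega
      · simp [bits, hm, weight]
  rw [key, ← Finset.sum_filter, Finset.filter_mem_eq_inter, Finset.inter_eq_right.2 h]

/-- The effect of an insertion at position `p` on the descent places. -/
theorem ins_bits {D D' : Finset ℕ} {m x : ℕ} (hx : x < m + 1)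
    (h : ∀ i, 1 ≤ i → (i ∈ D' ↔ (i < pos (bits D m) x ∧ i ∈ D) ∨ i = pos (bits D m) x ∨
      (pos (bits D m) x + 1 < i ∧ i - 1 ∈ D))) :
    ins (bits D m) x = bits D' (m + 1) := by
  induction m generalizing x with
  | zero =>
    obtain rfl : x = 0 := by omega
    have := h 1 le_rfl
    simp [bits, pos] at this
    simp [bits, ins, this]
  | succ m ih =>
    have hlt : ∀ y, y < m + 1 → pos (bits D m) y ≤ m := fun y hy => by
      have := pos_lt (u := bits D m) (x := y) (by rw [length_bits]; exact hy)
      rw [length_bits] at this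
      omega
    have top : ∀ p, p = m + 1 → (∀ i, 1 ≤ i → (i ∈ D' ↔ (i < p ∧ i ∈ D) ∨ i = p ∨
        (p + 1 < i ∧ i - 1 ∈ D))) → false :: true :: bits D m = bits D' (m + 2) := by
      rintro p rfl h
      have e1 : m + 2 ∉ D' := by rw [h _ (by omega)]; omega
      have e2 : m + 1 ∈ D' := by rw [h _ (by omega)]; omega
      have e3 : bits D m = bits D' m := bits_congr fun i h1 h2 => by
        rw [h i h1]
        constructor
        · exact fun h3 => Or.inl ⟨by omega, h3⟩
        · rintro (h3 | h3 | h3)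
          · exact h3.2
          · omega
          · omega
      simp [bits, e1, e2, e3]
    have low : ∀ y, y < m + 1 → (∀ i, 1 ≤ i → (i ∈ D' ↔ (i < pos (bits D m) y ∧ i ∈ D) ∨
        i = pos (bits D m) y ∨ (pos (bits D m) y + 1 < i ∧ i - 1 ∈ D))) →
        decide (m + 1 ∈ D) :: ins (bits D m) y = bits D' (m + 2) := by
      intro y hy h
      rw [ih hy h]
      have := hlt y hy
      have e : m + 1 + 1 ∈ D' ↔ m + 1 ∈ D := by
        rw [h _ (by omega), Nat.add_sub_cancel]
        constructor
        · rintro (h3 | h3 | h3)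
          · omega
          · omega
          · exact h3.2
        · exact fun h3 => Or.inr (Or.inr ⟨by omega, h3⟩)
      rw [bits, bits, bits]
      simp only [e]
    by_cases hm : m + 1 ∈ D
    · cases x with
      | zero =>
        simp only [bits, hm, decide_true, pos, length_bits] at h
        simp only [bits, hm, decide_true, ins]
        exact top _ rfl h
      | succ y =>
        simp only [bits, hm, decide_true, pos] at h
        have := low y (by omega) h
        simp only [hm, decide_true] at this
        simpa only [bits, hm, decide_true, ins] using this
    · by_cases hxm : x = m + 1
      · simp only [bits, hm, decide_false, pos, length_bits, hxm, if_true] at h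
        simp only [bits, hm, decide_false, ins, length_bits, hxm, if_true]
        exact top _ rfl h
      · simp only [bits, hm, decide_false, pos, length_bits, hxm, if_false] at h
        have := low x (by omega) h
        simp only [hm, decide_false] at this
        simpa only [bits, hm, decide_false, ins, length_bits, hxm, if_false] using this

theorem descentPlaces_subset (w : List ℕ) : descentPlaces w ⊆ Finset.Icc 1 w.length := fun i hi => by
  have := (mem_descentPlaces.1 hi).1
  exact Finset.mem_Icc.2 ⟨this.1, this.2.le⟩

theorem mem_descentPlaces_insert {v w : List ℕ} {a : ℕ} (hv : ∀ b ∈ v, a < b)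
    (hw : ∀ b ∈ w, a < b) {i : ℕ} (hi : 1 ≤ i) :
    i ∈ descentPlaces (v ++ a :: w) ↔ (i < v.length ∧ i ∈ descentPlaces (v ++ w)) ∨
      i = v.length ∨ (v.length + 1 < i ∧ i - 1 ∈ descentPlaces (v ++ w)) := by
  simp only [mem_descentPlaces]
  rcases lt_trichotomy i v.length with hlt | heq | hgt
  · rw [List.getD_append _ _ _ _ hlt, List.getD_append _ _ _ _ (by omega : i - 1 < v.length),
      List.getD_append _ _ _ _ hlt, List.getD_append _ _ _ _ (by omega : i - 1 < v.length)]
    simp only [List.length_append, List.length_cons]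
    constructor
    · rintro ⟨-, h⟩; exact Or.inl ⟨hlt, ⟨hi, by omega⟩, h⟩
    · rintro (⟨-, -, h⟩ | h | h)
      · exact ⟨⟨hi, by omega⟩, h⟩
      · omega
      · omega
  · have h1 : i - 1 < v.length := by omega
    rw [List.getD_append_right _ _ _ _ heq.ge, List.getD_append _ _ _ _ h1,
      List.getD_eq_getElem _ _ h1, show i - v.length = 0 by omega, List.getD_cons_zero]
    exact ⟨fun _ => Or.inr (Or.inl heq), fun _ => ⟨⟨hi, by simp; omega⟩, hv _ (List.getElem_mem _)⟩⟩
  · rcases (Nat.succ_le_of_lt hgt).eq_or_lt with heq | hgt'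
    · rw [List.getD_append_right v (a :: w) _ i (by omega),
        List.getD_append_right v (a :: w) _ (i - 1) (by omega),
        show i - v.length = 0 + 1 by omega, show i - 1 - v.length = 0 by omega]
      simp only [List.getD_cons_succ, List.getD_cons_zero, List.length_append, List.length_cons]
      constructor
      · rintro ⟨h1, h2⟩
        have h3 : 0 < w.length := by omega
        rw [List.getD_eq_getElem _ _ h3] at h2
        exact absurd (hw _ (List.getElem_mem h3)) (by omega)
      · omega
    · have hgt'' : v.length + 1 < i := hgt'
      rw [List.getD_append_right v (a :: w) _ i (by omega),
        List.getD_append_right v (a :: w) _ (i - 1) (by omega),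
        List.getD_append_right v w _ (i - 1) (by omega),
        List.getD_append_right v w _ (i - 1 - 1) (by omega),
        show i - v.length = (i - 1 - v.length) + 1 by omega,
        show i - 1 - v.length = (i - 1 - 1 - v.length) + 1 by omega]
      simp only [List.getD_cons_succ, List.length_append, List.length_cons]
      constructor
      · rintro ⟨h1, h2⟩
        exact Or.inr (Or.inr ⟨hgt'', ⟨by omega, by omega⟩, h2⟩)
      · rintro (h | h | h)
        · omega
        · omega
        · exact ⟨⟨hi, by omega⟩, h.2.2⟩

/-! ### Insertion of letters into permutations. -/

/-- The bit word of a word. -/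
def wordBits (w : List ℕ) : List Bool := bits (descentPlaces w) w.length

/-- Insertion of a new least letter into a word. -/
theorem exists_label {v w : List ℕ} {a : ℕ} (hv : ∀ b ∈ v, a < b) (hw : ∀ b ∈ w, a < b) :
    ∃ x, x ≤ (v ++ w).length ∧ pos (wordBits (v ++ w)) x = v.length ∧
      wordBits (v ++ a :: w) = ins (wordBits (v ++ w)) x ∧
      maj (v ++ a :: w) = maj (v ++ w) + x := by
  obtain ⟨x, hx, hp⟩ := pos_surj (u := wordBits (v ++ w)) (p := v.length)
    (by rw [wordBits, length_bits, List.length_append]; omega)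
  have hx' : x < (v ++ w).length + 1 := by rwa [wordBits, length_bits] at hx
  have hlen : (v ++ a :: w).length = (v ++ w).length + 1 := by
    simp only [List.length_append, List.length_cons]; omega
  have hins : wordBits (v ++ a :: w) = ins (wordBits (v ++ w)) x := by
    symm
    rw [wordBits, wordBits, hlen]
    refine ins_bits hx' fun i hi => ?_
    rw [wordBits] at hp
    rw [hp]
    exact mem_descentPlaces_insert hv hw hi
  refine ⟨x, Nat.le_of_lt_succ hx', hp, hins, ?_⟩
  rw [maj, maj, ← weight_bits (descentPlaces_subset _), ← weight_bits (descentPlaces_subset _)]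
  change weight (wordBits _) = weight (wordBits _) + x
  rw [hins, weight_ins hx]

theorem length_word {n : ℕ} (σ : Equiv.Perm (Fin n)) : (word σ).length = n := by simp [word]

/-- Cutting the word at the letter `i + 1`: the larger letters on its left are both the inversions
counted by `Ic σ i` and the prefix after which this letter is inserted. -/
theorem exists_eraseBelow_eq {n : ℕ} (σ : Equiv.Perm (Fin n)) (i : Fin n) :
    ∃ v w, eraseBelow σ (i + 1) = v ++ ((i : ℕ) + 1) :: w ∧ eraseBelow σ (i + 2) = v ++ w ∧
      (∀ b ∈ v, (i : ℕ) + 1 < b) ∧ (∀ b ∈ w, (i : ℕ) + 1 < b) ∧ Ic σ i = (v.length : ℤ) := by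
  set q := σ⁻¹ i with hq
  have hσ : σ q = i := by simp [hq]
  have hlen : (q : ℕ) < (word σ).length := by rw [length_word]; exact q.2
  have hget : ∀ k (hk : k < (word σ).length),
      (word σ)[k] = (σ ⟨k, by rwa [length_word] at hk⟩ : ℕ) + 1 := by
    intro k hk; simp [word]
  have hsplit : word σ = (word σ).take q ++ ((i : ℕ) + 1) :: (word σ).drop (q + 1) := by
    conv_lhs => rw [← List.take_append_drop q (word σ), List.drop_eq_getElem_cons hlen]
    rw [hget, Fin.eta, hσ]
  have hnd : (word σ).Nodup := by
    rw [word, List.nodup_ofFn]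
    intro a b h
    exact σ.injective (Fin.ext (by simpa using h))
  have hnd' := hnd
  rw [hsplit, List.nodup_append] at hnd'
  have n1 : ∀ x ∈ (word σ).take q, x ≠ (i : ℕ) + 1 := fun x hx =>
    hnd'.2.2 x hx _ (by simp)
  have n2 : ∀ x ∈ (word σ).drop (q + 1), x ≠ (i : ℕ) + 1 := fun x hx h =>
    (List.nodup_cons.1 hnd'.2.1).1 (h ▸ hx)
  have f : ∀ l : List ℕ, (∀ x ∈ l, x ≠ (i : ℕ) + 1) →
      l.filter (fun x => decide ((i : ℕ) + 1 ≤ x)) =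
        l.filter (fun x => decide ((i : ℕ) + 2 ≤ x)) := fun l hl =>
    List.filter_congr fun x hx => by
      have := hl x hx
      simp only [decide_eq_decide]
      omega
  refine ⟨((word σ).take q).filter (fun x => decide ((i : ℕ) + 2 ≤ x)),
    ((word σ).drop (q + 1)).filter (fun x => decide ((i : ℕ) + 2 ≤ x)), ?_, ?_, ?_, ?_, ?_⟩
  · rw [eraseBelow, hsplit, List.filter_append, List.filter_cons_of_pos (by simp), f _ n1, f _ n2,
      ← hsplit]
  · rw [eraseBelow, hsplit, List.filter_append, List.filter_cons_of_neg (by simp), ← hsplit]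
  · intro b hb
    have := (List.mem_filter.1 hb).2
    simp only [decide_eq_true_eq] at this
    omega
  · intro b hb
    have := (List.mem_filter.1 hb).2
    simp only [decide_eq_true_eq] at this
    omega
  · rw [Ic, Lc, Nat.cast_inj, ← List.toFinset_card_of_nodup ((hnd.sublist
      (List.take_sublist _ _)).filter _)]
    refine Finset.card_bij (fun j _ => (j : ℕ) + 1) ?_ ?_ ?_
    · intro j hj
      simp only [Finset.mem_filter, Finset.mem_univ, true_and] at hj
      simp only [List.mem_toFinset, List.mem_filter, decide_eq_true_eq]
      refine ⟨?_, by have := Fin.lt_def.1 hj.1; omega⟩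
      rw [List.mem_take_iff_getElem]
      refine ⟨σ⁻¹ j, ?_, ?_⟩
      · rw [lt_min_iff, length_word]
        exact ⟨Fin.lt_def.1 hj.2, (σ⁻¹ j).2⟩
      · rw [hget, Fin.eta]; simp
    · intro a _ b _ h
      exact Fin.ext (by simpa using h)
    · intro x hx
      simp only [List.mem_toFinset, List.mem_filter, decide_eq_true_eq] at hx
      obtain ⟨k, hk, hkx⟩ := List.mem_take_iff_getElem.1 hx.1
      rw [lt_min_iff] at hk
      rw [hget k hk.2] at hkx
      refine ⟨σ ⟨k, by have := hk.2; rwa [length_word] at this⟩, ?_, hkx⟩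
      simp only [Finset.mem_filter, Finset.mem_univ, true_and]
      refine ⟨Fin.lt_def.2 (by omega), ?_⟩
      change σ.symm (σ _) < q
      rw [Equiv.symm_apply_apply]
      exact Fin.lt_def.2 hk.1

/-- A word of integers as a list of natural numbers. -/
def codeList {n : ℕ} (d : Fin n → ℤ) : List ℕ := List.ofFn fun i => (d i).toNat

/-- The dictionary between permutations and codes, proved by downward induction on `k`, one inserted
letter at a time. -/
theorem codeList_drop {n : ℕ} (σ : Equiv.Perm (Fin n)) (k : ℕ) (hk : k ≤ n) :
    (eraseBelow σ (k + 1)).length = n - k ∧ Subdiag ((codeList (Mc σ)).drop k) ∧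
      wordBits (eraseBelow σ (k + 1)) = state ((codeList (Mc σ)).drop k) ∧
      (codeList (Ic σ)).drop k = positions ((codeList (Mc σ)).drop k) ∧
      ∀ i : Fin n, k ≤ i → 0 ≤ Mc σ i := by
  induction hk using Nat.decreasingInduction with
  | self =>
    have h1 : eraseBelow σ (n + 1) = [] := by
      rw [eraseBelow, List.filter_eq_nil_iff]
      intro x hx
      obtain ⟨i, rfl⟩ := (List.mem_ofFn' _ _).1 hx
      have := (σ i).2
      simp only [decide_eq_true_eq]
      omega
    have h2 : (codeList (Mc σ)).drop n = [] := by simp [codeList]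
    have h3 : (codeList (Ic σ)).drop n = [] := by simp [codeList]
    rw [h1, h2, h3]
    exact ⟨by simp, trivial, rfl, rfl, fun i hi => absurd i.2 (by omega)⟩
  | of_succ k hk ih =>
    obtain ⟨ih1, ih2, ih3, ih4, ih5⟩ := ih
    obtain ⟨v, w, e1, e2, hv, hw, hI⟩ := exists_eraseBelow_eq σ ⟨k, hk⟩
    obtain ⟨x, hx1, hx2, hx3, hx4⟩ := exists_label hv hw
    have hMc : Mc σ ⟨k, hk⟩ = x := by
      simp only [Mc, e1, e2, hx4]
      push_cast
      ring
    simp only at e1 e2 hx3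
    have d1 : (codeList (Mc σ)).drop k = x :: (codeList (Mc σ)).drop (k + 1) := by
      rw [List.drop_eq_getElem_cons (by simpa [codeList] using hk)]
      simp [codeList, hMc]
    have d2 : (codeList (Ic σ)).drop k = v.length :: (codeList (Ic σ)).drop (k + 1) := by
      rw [List.drop_eq_getElem_cons (by simpa [codeList] using hk)]
      simp [codeList, hI]
    change (eraseBelow σ (k + 2)).length = _ at ih1
    change wordBits (eraseBelow σ (k + 2)) = _ at ih3
    rw [e2] at ih1 ih3
    rw [e1, d1, d2]
    refine ⟨?_, ⟨?_, ih2⟩, ?_, ?_, ?_⟩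
    · simp only [List.length_append, List.length_cons] at ih1 ⊢; omega
    · refine hx1.trans ?_
      rw [ih1]; simp [codeList]
    · rw [hx3, state, ih3]
    · rw [positions, ← ih3, hx2, ih4]
    · intro i hi
      rcases hi.eq_or_lt with h | h
      · obtain rfl : i = ⟨k, hk⟩ := Fin.ext h.symm
        rw [hMc]; exact Int.natCast_nonneg _
      · exact ih5 i h


/-! ### The codes are bijections. -/

/-- Counting the smaller values not used before place `i` makes the entry depend only on `τ i` and
on the earlier letters. -/
theorem Lc_eq_card {n : ℕ} (τ : Equiv.Perm (Fin n)) (i : Fin n) :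
    Lc τ i = ((Finset.univ.filter fun v : Fin n => v < τ i ∧ i ≤ τ.symm v).card : ℤ) := by
  rw [Lc, Nat.cast_inj]
  refine Finset.card_bij (fun j _ => τ j) ?_ (fun a _ b _ h => τ.injective h) ?_
  · intro j hj
    simp only [Finset.mem_filter, Finset.mem_univ, true_and, Equiv.symm_apply_apply] at hj ⊢
    exact ⟨hj.2, hj.1.le⟩
  · intro v hv
    simp only [Finset.mem_filter, Finset.mem_univ, true_and] at hv
    refine ⟨τ.symm v, ?_, by simp⟩
    simp only [Finset.mem_filter, Finset.mem_univ, true_and, Equiv.apply_symm_apply]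
    refine ⟨lt_of_le_of_ne hv.2 ?_, hv.1⟩
    rintro rfl
    simp at hv

/-- At the first place where two permutations differ, the smaller letter has the smaller code entry.
-/
theorem Lc_injective {n : ℕ} : Function.Injective (Lc (n := n)) := by
  have aux : ∀ (τ τ' : Equiv.Perm (Fin n)) (i : Fin n), (∀ j < i, τ j = τ' j) → τ i < τ' i →
      Lc τ i < Lc τ' i := by
    intro τ τ' i h hlt
    rw [Lc_eq_card, Lc_eq_card, Nat.cast_lt]
    refine Finset.card_lt_card (Finset.ssubset_iff_subset_ne.2 ⟨?_, ?_⟩)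
    · intro v hv
      simp only [Finset.mem_filter, Finset.mem_univ, true_and] at hv ⊢
      refine ⟨hv.1.trans hlt, ?_⟩
      by_contra! hc
      have h1 := h _ hc
      rw [Equiv.apply_symm_apply, ← Equiv.eq_symm_apply] at h1
      exact absurd hv.2 (by rw [← h1]; exact not_le.2 hc)
    · intro he
      have : τ i ∈ Finset.univ.filter fun v : Fin n => v < τ i ∧ i ≤ τ.symm v := by
        rw [he]
        simp only [Finset.mem_filter, Finset.mem_univ, true_and]
        refine ⟨hlt, ?_⟩
        by_contra! hc
        have h1 := h _ hc
        rw [Equiv.apply_symm_apply] at h1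
        exact absurd (τ.injective h1) hc.ne
      simp at this
  intro τ τ' h
  ext i : 1
  induction hk : (i : ℕ) using Nat.strong_induction_on generalizing i with
  | _ k ih =>
    have hj : ∀ j < i, τ j = τ' j := fun j hj => ih j (hk ▸ Fin.lt_def.1 hj) j rfl
    rcases lt_trichotomy (τ i) (τ' i) with h1 | h1 | h1
    · exact absurd (congrFun h i) (aux τ τ' i hj h1).ne
    · exact h1
    · exact absurd (congrFun h i) (aux τ' τ i (fun j hji => (hj j hji).symm) h1).ne'

theorem isSubdiagonal_Lc {n : ℕ} (τ : Equiv.Perm (Fin n)) : IsSubdiagonal (Lc τ) := by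
  intro i
  refine ⟨Int.natCast_nonneg _, ?_⟩
  have h1 : (Finset.univ.filter fun j : Fin n => i < j ∧ τ j < τ i).card ≤ (Finset.Ioi i).card :=
    Finset.card_le_card fun j hj => by
      simp only [Finset.mem_filter, Finset.mem_univ, true_and] at hj
      exact Finset.mem_Ioi.2 hj.1
  rw [Fin.card_Ioi] at h1
  rw [Lc]
  have := i.2
  omega

/-- There are `n!` subdiagonal words, so injectivity suffices. -/
theorem bijOn_subdiagonal_of_injective {n : ℕ} {f : Equiv.Perm (Fin n) → Fin n → ℤ}
    (hf : Function.Injective f) (h : ∀ σ, IsSubdiagonal (f σ)) :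
    Set.BijOn f Set.univ {d | IsSubdiagonal d} := by
  set S : Finset (Fin n → ℤ) :=
    Fintype.piFinset fun i : Fin n => Finset.Icc (0 : ℤ) ((n : ℤ) - ((i : ℕ) + 1)) with hS
  have hmem : ∀ d, d ∈ S ↔ IsSubdiagonal d := fun d => by
    simp [hS, Fintype.mem_piFinset, IsSubdiagonal]
  have hcard : S.card = n.factorial := by
    rw [hS, Fintype.card_piFinset, ← Nat.descFactorial_self, Nat.descFactorial_eq_prod_range,
      ← Fin.prod_univ_eq_prod_range (fun i => n - i)]
    refine Finset.prod_congr rfl fun i _ => ?_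
    rw [Int.card_Icc]
    have := i.2
    omega
  refine ⟨fun σ _ => h σ, hf.injOn, fun d hd => ?_⟩
  have := Finset.surjOn_of_injOn_of_card_le (s := (Finset.univ : Finset (Equiv.Perm (Fin n))))
    (t := S) f (fun σ _ => (hmem _).2 (h σ)) hf.injOn
    (by rw [hcard, Finset.card_univ, Fintype.card_perm, Fintype.card_fin])
  obtain ⟨σ, -, hσ⟩ := this ((hmem d).2 hd)
  exact ⟨σ, trivial, hσ⟩

theorem subdiag_ofFn_iff {n : ℕ} (f : Fin n → ℕ) :
    Subdiag (List.ofFn f) ↔ ∀ i : Fin n, f i + i + 1 ≤ n := by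
  induction n with
  | zero => simp [Subdiag]
  | succ n ih =>
    rw [List.ofFn_succ, Subdiag, ih, Fin.forall_fin_succ, List.length_ofFn]
    simp only [Fin.val_zero, Fin.val_succ]
    refine and_congr (by omega) (forall_congr' fun i => by omega)

theorem bijOn_codeList (n : ℕ) : Set.BijOn (codeList (n := n)) {d | IsSubdiagonal d}
    {c | c.length = n ∧ Subdiag c} := by
  refine ⟨fun d hd => ⟨by simp [codeList], ?_⟩, fun d hd d' hd' h => ?_, fun c hc => ?_⟩
  · rw [codeList, subdiag_ofFn_iff]
    intro i
    have := hd i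
    omega
  · funext i
    have h1 := congrFun (List.ofFn_injective h) i
    have h2 := (hd i).1
    have h3 := (hd' i).1
    omega
  · obtain ⟨rfl, hc⟩ := hc
    have e : List.ofFn c.get = c := List.ofFn_get c
    refine ⟨fun i => (c.get i : ℤ), fun i => ?_, ?_⟩
    · rw [← e, subdiag_ofFn_iff] at hc
      have := hc i
      change 0 ≤ (c.get i : ℤ) ∧ (c.get i : ℤ) ≤ _
      omega
    · simp only [codeList, Int.toNat_natCast]
      exact e

theorem Ic_bijOn (n : ℕ) : Set.BijOn (Ic (n := n)) Set.univ {d | IsSubdiagonal d} :=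
  bijOn_subdiagonal_of_injective (fun _ _ h => inv_injective (Lc_injective h))
    fun σ => isSubdiagonal_Lc σ⁻¹

theorem isSubdiagonal_Mc {n : ℕ} (σ : Equiv.Perm (Fin n)) : IsSubdiagonal (Mc σ) := by
  have h := codeList_drop σ 0 (Nat.zero_le n)
  intro i
  refine ⟨h.2.2.2.2 i (Nat.zero_le _), ?_⟩
  have h2 := h.2.1
  rw [List.drop_zero, codeList, subdiag_ofFn_iff] at h2
  have := h2 i
  omega

theorem codeList_Ic {n : ℕ} (σ : Equiv.Perm (Fin n)) :
    codeList (Ic σ) = positions (codeList (Mc σ)) := by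
  have h := (codeList_drop σ 0 (Nat.zero_le n)).2.2.2.1
  rwa [List.drop_zero, List.drop_zero] at h

/-- `Mc` determines `Ic` through `positions`, and `Ic` is injective. -/
theorem Mc_injective {n : ℕ} : Function.Injective (Mc (n := n)) := fun σ τ h => by
  refine (Ic_bijOn n).injOn trivial trivial ((bijOn_codeList n).injOn
    (isSubdiagonal_Lc _) (isSubdiagonal_Lc _) ?_)
  change codeList (Ic σ) = codeList (Ic τ)
  rw [codeList_Ic, codeList_Ic, h]

theorem Mc_bijOn (n : ℕ) : Set.BijOn (Mc (n := n)) Set.univ {d | IsSubdiagonal d} :=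
  bijOn_subdiagonal_of_injective Mc_injective isSubdiagonal_Mc

/-! ### The three statistics on codes, and the transfer of counts. -/

theorem El_Mc {n : ℕ} (σ : Equiv.Perm (Fin n)) : El (Mc σ) = Ligne σ := by
  rw [El, show (Finset.univ.filter fun τ : Equiv.Perm (Fin n) => Mc τ = Mc σ) = {σ} by
    ext τ; simp [Mc_injective.eq_iff], Finset.singleton_biUnion]

/-- Makes `El` available on every subdiagonal word, hence also on `Ic σ`, without reference to a
permutation. -/
theorem El_eq {n : ℕ} {d : Fin n → ℤ} (hd : IsSubdiagonal d) :
    El d = descentsOfBits (state (codeList d)) := by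
  obtain ⟨σ, -, rfl⟩ := (Mc_bijOn n).surjOn hd
  have h := (codeList_drop σ 0 (Nat.zero_le n)).2.2.1
  have he : eraseBelow σ (0 + 1) = word σ := by
    rw [eraseBelow, List.filter_eq_self]
    intro x hx
    obtain ⟨i, rfl⟩ := (List.mem_ofFn' _ _).1 hx
    simp
  rw [he, List.drop_zero] at h
  rw [El_Mc, Ligne, ← descentsOfBits_bits (descentPlaces_subset (word σ))]
  exact congrArg descentsOfBits h

/-- At a descent, `i` counts everything that `j` counts, and `j` itself. At an ascent, everything
counted for `i` lies beyond `j` and is counted for `j` too. -/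
theorem Lc_succ_lt_iff {n : ℕ} (τ : Equiv.Perm (Fin n)) {i j : Fin n} (hij : (j : ℕ) = i + 1) :
    Lc τ j < Lc τ i ↔ τ j < τ i := by
  have hlt : i < j := Fin.lt_def.2 (by omega)
  constructor
  · contrapose!
    intro h
    have h' : τ i < τ j := lt_of_le_of_ne h fun e => hlt.ne (τ.injective e)
    rw [Lc, Lc, Nat.cast_le]
    refine Finset.card_le_card fun k hk => ?_
    simp only [Finset.mem_filter, Finset.mem_univ, true_and] at hk ⊢
    have hne : k ≠ j := by rintro rfl; exact lt_asymm hk.2 h'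
    have := Fin.lt_def.1 hk.1
    have : (k : ℕ) ≠ j := fun e => hne (Fin.ext e)
    exact ⟨Fin.lt_def.2 (by omega), hk.2.trans h'⟩
  · intro h
    rw [Lc, Lc, Nat.cast_lt]
    refine Finset.card_lt_card (Finset.ssubset_iff_subset_ne.2 ⟨fun k hk => ?_, fun he => ?_⟩)
    · simp only [Finset.mem_filter, Finset.mem_univ, true_and] at hk ⊢
      exact ⟨hlt.trans hk.1, hk.2.trans h⟩
    · have : j ∈ Finset.univ.filter fun k : Fin n => i < k ∧ τ k < τ i := by simp [hlt, h]
      rw [← he] at this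
      simp at this

theorem Iligne_eq {n : ℕ} (σ : Equiv.Perm (Fin n)) :
    Iligne σ = descentPlaces (codeList (Ic σ)) := by
  ext i
  rw [Iligne, Ligne, mem_descentPlaces, mem_descentPlaces, length_word,
    show (codeList (Ic σ)).length = n by simp [codeList]]
  refine and_congr_right fun hi => ?_
  have h1 : i - 1 < n := by omega
  rw [List.getD_eq_getElem _ _ (by rw [length_word]; exact hi.2),
    List.getD_eq_getElem _ _ (by rw [length_word]; exact h1),
    List.getD_eq_getElem _ _ (by simpa [codeList] using hi.2),
    List.getD_eq_getElem _ _ (by simpa [codeList] using h1)]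
  have key := Lc_succ_lt_iff σ⁻¹ (i := ⟨i - 1, h1⟩) (j := ⟨i, hi.2⟩) (by simp; omega)
  have n1 := (isSubdiagonal_Lc σ⁻¹ ⟨i - 1, h1⟩).1
  have n2 := (isSubdiagonal_Lc σ⁻¹ ⟨i, hi.2⟩).1
  simp only [word, codeList, List.getElem_ofFn, Ic]
  rw [Nat.add_lt_add_iff_right, ← Fin.lt_def, ← key]
  omega

/-- The nondecreasing rearrangement of a code and the descent set it determines. -/
def codeStats (c : List ℕ) : List ℤ × Finset ℕ :=
  ((c.map fun x : ℕ => (x : ℤ)).insertionSort (· ≤ ·), descentsOfBits (state c))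

theorem codeStats_codeList {n : ℕ} {d : Fin n → ℤ} (hd : IsSubdiagonal d) :
    codeStats (codeList d) = (sortWord d, El d) := by
  rw [codeStats, El_eq hd, sortWord, codeList, List.map_ofFn]
  congr 3
  funext i
  exact Int.toNat_of_nonneg (hd i).1

theorem codeStats_eq {c c' : List ℕ} (h : c.Perm c') (hs : state c = state c') :
    codeStats c = codeStats c' := by
  rw [codeStats, codeStats, hs]
  congr 1
  refine List.Perm.eq_of_pairwise' (r := (· ≤ ·)) (List.pairwise_insertionSort _ _)
    (List.pairwise_insertionSort _ _) ?_
  exact (List.perm_insertionSort _ _).trans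
    ((h.map _).trans (List.perm_insertionSort _ _).symm)

theorem ncard_subdiagSet_eq (n : ℕ) (T : Set ℕ) (k : List ℤ × Finset ℕ) :
    {c ∈ subdiagSet positions n T | codeStats c = k}.ncard =
      {c ∈ subdiagSet id n T | codeStats c = k}.ncard := by
  obtain ⟨f, hf, hfs⟩ := exists_bijOn n T
  refine Set.BijOn.ncard_eq (f := f) ⟨fun c hc => ⟨hf.mapsTo hc.1, ?_⟩,
    hf.injOn.mono fun c hc => hc.1, fun c hc => ?_⟩
  · rw [codeStats_eq (hfs c hc.1).1 (hfs c hc.1).2]; exact hc.2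
  · obtain ⟨b, hb, rfl⟩ := hf.surjOn hc.1
    refine ⟨b, ⟨hb, ?_⟩, rfl⟩
    rw [← codeStats_eq (hfs b hb).1 (hfs b hb).2]; exact hc.2

/-- Transfer of a count from permutations to codes. -/
theorem card_filter_eq_ncard {n : ℕ} {C : Equiv.Perm (Fin n) → Fin n → ℤ}
    (hC : Set.BijOn C Set.univ {d | IsSubdiagonal d}) {f : List ℕ → List ℕ}
    (hf : ∀ σ, Iligne σ = descentPlaces (f (codeList (C σ)))) (T : Finset ℕ)
    (k : List ℤ × Finset ℕ) :
    ((Finset.univ.filter fun σ => (sortWord (C σ), El (C σ)) = k).filter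
      fun σ => Iligne σ ⊆ T).card = {c ∈ subdiagSet f n T | codeStats c = k}.ncard := by
  have hb := (bijOn_codeList n).comp hC
  have hst : ∀ σ, codeStats (codeList (C σ)) = (sortWord (C σ), El (C σ)) := fun σ =>
    codeStats_codeList (hC.mapsTo trivial)
  rw [← Set.ncard_coe_finset]
  refine Set.BijOn.ncard_eq (f := codeList ∘ C)
    ⟨fun σ hσ => ?_, hb.injOn.mono (Set.subset_univ _), fun c hc => ?_⟩
  · simp only [Finset.coe_filter, Finset.mem_filter, Finset.mem_univ, true_and] at hσ
    have h1 := hb.mapsTo (Set.mem_univ σ)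
    refine ⟨⟨h1.1, h1.2, fun i hi => hσ.2 ?_⟩, (hst σ).trans hσ.1⟩
    rw [hf]; exact hi
  · obtain ⟨⟨h1, h2, h3⟩, h4⟩ := hc
    obtain ⟨σ, -, rfl⟩ := hb.surjOn ⟨h1, h2⟩
    refine ⟨σ, ?_, rfl⟩
    simp only [Finset.coe_filter, Finset.mem_filter, Finset.mem_univ, true_and]
    refine ⟨(hst σ).symm.trans h4, fun i hi => h3 i ?_⟩
    rw [hf] at hi; exact hi

end EulerMahonian

open EulerMahonian
theorem theorem1 (n : ℕ) :
    -- `Mc` and `Ic` are bijections of `S_n` onto the set of subdiagonal words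
    Set.BijOn (Mc (n := n)) Set.univ {d | IsSubdiagonal d} ∧
    Set.BijOn (Ic (n := n)) Set.univ {d | IsSubdiagonal d} ∧
    -- so `El` is the map on subdiagonal words that is determined by `Ligne σ = El (Mc σ)`
    (∀ σ : Equiv.Perm (Fin n), Ligne σ = El (Mc σ)) ∧
    -- the two triples are equidistributed on `S_n`
    Equidistributed
      (fun σ : Equiv.Perm (Fin n) => (Iligne σ, sortWord (Mc σ), El (Mc σ)))
      (fun σ : Equiv.Perm (Fin n) => (Iligne σ, sortWord (Ic σ), El (Ic σ))) := by
  refine ⟨Mc_bijOn n, Ic_bijOn n, fun σ => (El_Mc σ).symm, ?_⟩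
  rintro ⟨T, k⟩
  have split : ∀ C : Equiv.Perm (Fin n) → Fin n → ℤ,
      (Finset.univ.filter fun σ => (Iligne σ, sortWord (C σ), El (C σ)) = (T, k)) =
        (Finset.univ.filter fun σ => (sortWord (C σ), El (C σ)) = k).filter
          fun σ => Iligne σ = T := fun C => by
    rw [Finset.filter_filter]
    exact Finset.filter_congr fun σ _ => by rw [Prod.mk_inj, and_comm]
  rw [split Mc, split Ic]
  -- With the value `k` of the last two statistics fixed, equality of `Iligne` with a set is
  -- replaced by containment.
  refine card_filter_eq_of_card_filter_subset _ _ _ _ (fun T => ?_) T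
  rw [card_filter_eq_ncard (Mc_bijOn n) (fun σ => by rw [Iligne_eq, codeList_Ic]),
    card_filter_eq_ncard (f := id) (Ic_bijOn n) Iligne_eq, ncard_subdiagSet_eq]
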